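/- A group $H$ is called quasi-simple if $H$ is perfect and $H/Z(H)$ is simple (simple groups being non-trivial). A component of a finite group $G$ is a subnormal quasi-simple subgroup of $G$, and the layer $E(G)$ of $G$ is the product of all components of $G$ (the trivial subgroup if there are none). Let $F(G)$ be the Fitting subgroup of $G$, that is, the largest nilpotent normal subgroup of $G$. The generalised Fitting subgroup of $G$ is the product $F^*(G) = E(G)F(G)$. A normal subgroup $N$ of $G$ is called large in $G$ if $C_G(N) \leq N$. **Corollary E.** If $G$ is a finite group, then the generalised Fitting subgroup $F^*(G)$ of $G$ is large in $G$; that is, $F^*(G)$ is a normal subgroup of $G$ and $C_G(F^*(G)) \leq F^*(G)$. -/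

import Mathlib

/-- A group `G` is quasi-simple if it is perfect and `G / Z(G)` is simple. (Mathlib's simple groups
are nontrivial, so the trivial group is not quasi-simple.) -/
structure IsQuasiSimpleGroup (G : Type*) [Group G] : Prop where
  perfect : Group.IsPerfect G
  simple_quotient : IsSimpleGroup (G ⧸ Subgroup.center G)

/-- A component of `G` is a subnormal quasi-simple subgroup of `G`. -/
structure IsComponent {G : Type*} [Group G] (H : Subgroup G) : Prop where
  subnormal : H.IsSubnormal
  quasiSimple : IsQuasiSimpleGroup H

/-- The layer of `G`: the product of its components. Distinct components commute elementwise in a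
finite group, so this product is the subgroup generated by all of them. -/
def layer (G : Type*) [Group G] : Subgroup G :=
  sSup {H : Subgroup G | IsComponent H}

/-- The Fitting subgroup of `G`: the subgroup generated by all nilpotent normal subgroups of `G`.
For finite `G` it is the largest nilpotent normal subgroup. -/
def fittingSubgroup (G : Type*) [Group G] : Subgroup G :=
  sSup {N : Subgroup G | N.Normal ∧ Group.IsNilpotent N}

/-- The generalised Fitting subgroup of `G`: the product of the layer and the Fitting subgroup.
Both factors are normal, so the product of the two is their join. -/
def generalisedFittingSubgroup (G : Type*) [Group G] : Subgroup G :=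
  layer G ⊔ fittingSubgroup G

/-- A subgroup `N` of `G` is large if it is normal in `G` and contains its centraliser in `G`. -/
structure IsLarge {G : Type*} [Group G] (N : Subgroup G) : Prop where
  normal : N.Normal
  centralizer_le : Subgroup.centralizer (N : Set G) ≤ N

/-!
The generalised Fitting subgroup `F*(G)` of a finite group contains its centraliser `C`.

Suppose that `C` is not contained in `F*(G)`, and consider the subnormal subgroups of `G` that lie
in `C`. Since `C` commutes with `F*(G)`, a subgroup `H ≤ C` whose commutator subgroup lies in
`F*(G)` is nilpotent of class at most two; if `H` is moreover normal in `G`, then it lies in the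
Fitting subgroup. Running down the derived series, every *solvable* normal subgroup of `G` inside
`C` lies in `F*(G)` (`le_generalisedFittingSubgroup_of_isSolvable`). A subnormal solvable subgroup
lies in the solvable radical (`Subgroup.IsSubnormal.le_solvableRadical`), so the same holds for
subnormal solvable subgroups of `C`.

Now let `N` be minimal among the subnormal subgroups of `G` that lie in `C` but not in `F*(G)`. All
proper normal subgroups of `N` lie in `C ⊓ F*(G)`, hence are central in `N`; so `N` is perfect
(otherwise it would be solvable) and `N / Z(N)` is simple. Thus `N` is a component of `G`, and lies
in the layer, a contradiction.
-/

/-! ### Characteristic joins and the solvable radical -/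

theorem Subgroup.characteristic_sSup_of_forall_map_mem {G : Type*} [Group G] {S : Set (Subgroup G)}
    (hS : ∀ φ : G ≃* G, ∀ H ∈ S, H.map φ.toMonoidHom ∈ S) : (sSup S).Characteristic :=
  Subgroup.characteristic_iff_map_le.2 fun φ =>
    Subgroup.map_le_iff_le_comap.2 <| sSup_le fun H hH =>
      Subgroup.map_le_iff_le_comap.1 <| le_sSup (hS φ H hH)

/-- The solvable radical of `G`: the subgroup generated by all solvable normal subgroups of `G`.
For finite `G` it is itself solvable. -/
def solvableRadical (G : Type*) [Group G] : Subgroup G :=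
  sSup {N : Subgroup G | N.Normal ∧ Group.IsSolvable N}

theorem Subgroup.isSolvable_map {G H : Type*} [Group G] [Group H] (f : G →* H) (K : Subgroup G)
    [Group.IsSolvable K] : Group.IsSolvable (K.map f) :=
  Group.isSolvable_of_surjective (f.subgroupMap_surjective K)

instance solvableRadical_characteristic (G : Type*) [Group G] :
    (solvableRadical G).Characteristic :=
  Subgroup.characteristic_sSup_of_forall_map_mem fun φ _ ⟨hn, _⟩ =>
    ⟨hn.map _ φ.surjective, Subgroup.isSolvable_map _ _⟩

theorem Subgroup.isSolvable_sup {G : Type*} [Group G] (H K : Subgroup G) [K.Normal]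
    [Group.IsSolvable H] [Group.IsSolvable K] : Group.IsSolvable (H ⊔ K : Subgroup G) := by
  rw [Group.isSolvable_iff_subgroup_quotient (K.subgroupOf (H ⊔ K))]
  refine ⟨Group.isSolvable_of_isSolvable_injective
    (f := (Subgroup.subgroupOfEquivOfLe (le_sup_right : K ≤ H ⊔ K)).toMonoidHom)
    (MulEquiv.injective _), ?_⟩
  exact Group.isSolvable_of_surjective
    (f := (QuotientGroup.quotientInfEquivProdNormalQuotient H K).toMonoidHom)
    (MulEquiv.surjective _)

instance isSolvable_solvableRadical (G : Type*) [Group G] [Finite G] :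
    Group.IsSolvable (solvableRadical G) := by
  have hsup : SupClosed {N : Subgroup G | N.Normal ∧ Group.IsSolvable N} := by
    rintro H ⟨_, _⟩ K ⟨_, _⟩
    exact ⟨inferInstance, Subgroup.isSolvable_sup H K⟩
  have hbot : (⊥ : Subgroup G) ∈ {N : Subgroup G | N.Normal ∧ Group.IsSolvable N} :=
    ⟨inferInstance, inferInstance⟩
  exact (hsup.sSup_mem_of_nonempty (Set.toFinite _) ⟨⊥, hbot⟩ subset_rfl).2

/-- A subnormal solvable subgroup of a finite group lies in the solvable radical: unless it is the
whole group, it lies in a proper normal subgroup `K`, and the solvable radical of `K`, being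
characteristic in `K`, is normal in `G`. -/
theorem Subgroup.IsSubnormal.le_solvableRadical {G : Type*} [Group G] [Finite G] {H : Subgroup G}
    (hH : H.IsSubnormal) [Group.IsSolvable H] : H ≤ solvableRadical G := by
  obtain rfl | ⟨K, hK, hHK, hlt⟩ := hH.lt_normal
  · exact le_sSup ⟨inferInstance, inferInstance⟩
  · have hcard : Nat.card K < Nat.card G := by
      simpa using Set.Finite.card_lt_card (Set.toFinite _) (SetLike.coe_ssubset_coe.2 hlt)
    have : Group.IsSolvable (H.subgroupOf K) :=
      Group.isSolvable_of_isSolvable_injective (f := (Subgroup.subgroupOfEquivOfLe hHK).toMonoidHom)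
        (MulEquiv.injective _)
    have hle : H.subgroupOf K ≤ solvableRadical K :=
      Subgroup.IsSubnormal.le_solvableRadical hH.subgroupOf
    rw [← Subgroup.map_subgroupOf_eq_of_le hHK]
    exact (Subgroup.map_mono hle).trans
      (le_sSup ⟨inferInstance, Subgroup.isSolvable_map _ _⟩)
termination_by Nat.card G

/-! ### Normality of the generalised Fitting subgroup -/

theorem IsQuasiSimpleGroup.of_mulEquiv {G H : Type*} [Group G] [Group H] (e : G ≃* H)
    (hG : IsQuasiSimpleGroup G) : IsQuasiSimpleGroup H := by
  have hmap : (Subgroup.center G).map e.toMonoidHom = Subgroup.center H := by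
    ext x
    obtain ⟨y, rfl⟩ := e.surjective x
    simp [Subgroup.mem_center_iff, Subgroup.mem_map, e.surjective.forall,
      ← map_mul]
  have := hG.perfect
  have := hG.simple_quotient
  exact ⟨Group.IsPerfect.ofSurjective (f := e.toMonoidHom) e.surjective,
    (QuotientGroup.congr _ _ e hmap).symm.isSimpleGroup⟩

theorem IsComponent.map {G : Type*} [Group G] {H : Subgroup G} (hH : IsComponent H)
    (φ : G ≃* G) : IsComponent (H.map φ.toMonoidHom) :=
  ⟨hH.subnormal.map φ.surjective, hH.quasiSimple.of_mulEquiv (φ.subgroupMap H)⟩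

instance layer_characteristic (G : Type*) [Group G] : (layer G).Characteristic :=
  Subgroup.characteristic_sSup_of_forall_map_mem fun φ _ hH => hH.map φ

instance fittingSubgroup_normal (G : Type*) [Group G] : (fittingSubgroup G).Normal :=
  Subgroup.sSup_normal _ fun _ hN => hN.1

instance generalisedFittingSubgroup_normal (G : Type*) [Group G] :
    (generalisedFittingSubgroup G).Normal :=
  Subgroup.sup_normal _ _

/-! ### Subnormal subgroups of the centraliser -/

theorem Subgroup.isNilpotent_of_commutator_le_centralizer {G : Type*} [Group G] {H : Subgroup G}
    (h : ⁅H, H⁆ ≤ Subgroup.centralizer H) : Group.IsNilpotent H := by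
  refine Subgroup.isNilpotent_of_lowerCentralSeries_eq_bot (n := 2) ?_
  exact Subgroup.commutator_eq_bot_iff_le_centralizer.2 h

/-- A solvable normal subgroup commuting with the generalised Fitting subgroup lies in it: otherwise
the last term of its derived series outside would be normal and nilpotent of class at most two. -/
theorem le_generalisedFittingSubgroup_of_isSolvable {G : Type*} [Group G] {D : Subgroup G}
    [hD : D.Normal] [Group.IsSolvable D]
    (hDC : D ≤ Subgroup.centralizer (generalisedFittingSubgroup G : Set G)) :
    D ≤ generalisedFittingSubgroup G := by
  obtain ⟨n, hn⟩ := Group.IsSolvable.solvable (G := D)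
  have key : ∀ k ≤ n, (derivedSeries D k).map D.subtype ≤ generalisedFittingSubgroup G := by
    intro k hk
    induction hk using Nat.decreasingInduction with
    | self => simp [hn]
    | of_succ k _ ih =>
      set A := (derivedSeries D k).map D.subtype
      have hAC : A ≤ Subgroup.centralizer (generalisedFittingSubgroup G : Set G) :=
        (Subgroup.map_subtype_le _).trans hDC
      rw [derivedSeries_succ, Subgroup.map_commutator] at ih
      have hA : Group.IsNilpotent A := Subgroup.isNilpotent_of_commutator_le_centralizer <|
        ih.trans (Subgroup.le_centralizer_iff.1 hAC)
      have hAF : A ≤ fittingSubgroup G := le_sSup ⟨inferInstance, hA⟩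
      exact hAF.trans le_sup_right
  simpa [← MonoidHom.range_eq_map] using key 0 n.zero_le

theorem Subgroup.IsSubnormal.le_generalisedFittingSubgroup_of_isSolvable {G : Type*} [Group G]
    [Finite G] {H : Subgroup G} (hH : H.IsSubnormal) [Group.IsSolvable H]
    (hHC : H ≤ Subgroup.centralizer (generalisedFittingSubgroup G : Set G)) :
    H ≤ generalisedFittingSubgroup G := by
  set C := Subgroup.centralizer (generalisedFittingSubgroup G : Set G)
  have : Group.IsSolvable (solvableRadical G ⊓ C : Subgroup G) :=
    Group.isSolvable_of_isSolvable_injective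
      (Subgroup.inclusion_injective (inf_le_left : solvableRadical G ⊓ C ≤ _))
  exact (le_inf hH.le_solvableRadical hHC).trans
    (_root_.le_generalisedFittingSubgroup_of_isSolvable inf_le_right)

/-- A perfect nontrivial group is quasi-simple if its proper normal subgroups are central. -/
theorem IsQuasiSimpleGroup.of_forall_normal {G : Type*} [Group G] [Nontrivial G]
    (hp : Group.IsPerfect G)
    (h : ∀ M : Subgroup G, M.Normal → M ≠ ⊤ → M ≤ Subgroup.center G) :
    IsQuasiSimpleGroup G := by
  have hc : Subgroup.center G ≠ ⊤ := fun hc =>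
    Group.IsPerfect.not_isSolvable G <| Group.isSolvable_of_comm fun a b =>
      (Subgroup.mem_center_iff.1 (hc ▸ Subgroup.mem_top b : b ∈ Subgroup.center G) a)
  refine ⟨hp, ?_⟩
  have := QuotientGroup.nontrivial_iff.2 hc
  refine ⟨fun M hM => ?_⟩
  have hsurj := QuotientGroup.mk'_surjective (Subgroup.center G)
  rw [← Subgroup.map_comap_eq_self_of_surjective hsurj M]
  by_cases hM' : M.comap (QuotientGroup.mk' (Subgroup.center G)) = ⊤
  · right
    rw [hM', Subgroup.map_top_of_surjective _ hsurj]
  · left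
    rw [Subgroup.map_eq_bot_iff, QuotientGroup.ker_mk']
    exact h _ (hM.comap _) hM'

theorem centralizer_generalisedFittingSubgroup_le (G : Type*) [Group G] [Finite G] :
    Subgroup.centralizer (generalisedFittingSubgroup G : Set G) ≤
      generalisedFittingSubgroup G := by
  set F := generalisedFittingSubgroup G
  set C := Subgroup.centralizer (F : Set G)
  by_contra hCF
  have hCn : C.Normal := inferInstance
  obtain ⟨N, ⟨hNs, hNC, hNF⟩, hmin⟩ :=
    (Set.toFinite {N : Subgroup G | N.IsSubnormal ∧ N ≤ C ∧ ¬ N ≤ F}).exists_minimal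
      ⟨C, hCn.isSubnormal, le_rfl, hCF⟩
  -- By minimality of `N`, its proper normal subgroups lie in `F`.
  have hsub : ∀ M : Subgroup N, M.Normal → M ≠ ⊤ → M.map N.subtype ≤ F := by
    intro M hM hne
    by_contra hMF
    have hle : N ≤ M.map N.subtype :=
      hmin ⟨hM.isSubnormal.trans' hNs, (Subgroup.map_subtype_le M).trans hNC, hMF⟩
        (Subgroup.map_subtype_le M)
    refine hne (eq_top_iff.2 fun x _ => ?_)
    obtain ⟨y, hy, hyx⟩ := hle x.2
    exact Subtype.ext hyx ▸ hy
  have hns : ¬ Group.IsSolvable N := fun _ =>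
    hNF (hNs.le_generalisedFittingSubgroup_of_isSolvable hNC)
  have : Nontrivial N := not_subsingleton_iff_nontrivial.1 fun _ => hns inferInstance
  have hperf : Group.IsPerfect N := by
    rw [Group.isPerfect_def]
    by_contra hne
    -- If `N` is not perfect, then its commutator subgroup lies in `F`, which commutes with `N`.
    have hle := hsub (commutator N) inferInstance hne
    rw [Subgroup.map_subtype_commutator] at hle
    have := Subgroup.isNilpotent_of_commutator_le_centralizer
      (hle.trans ((Subgroup.le_centralizer_iff.1 le_rfl).trans (Subgroup.centralizer_le hNC)))
    exact hns IsNilpotent.to_isSolvable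
  have hcomp : IsComponent N := by
    refine ⟨hNs, .of_forall_normal hperf fun M hM hne x hx => ?_⟩
    have hxF : (x : G) ∈ F := hsub M hM hne (Subgroup.mem_map_of_mem N.subtype hx)
    exact Subgroup.mem_center_iff.2 fun y => Subtype.ext
      (Subgroup.mem_centralizer_iff.1 (hNC y.2) x hxF).symm
  exact hNF (le_trans (le_sSup hcomp) le_sup_left)

theorem corollaryE (G : Type*) [Group G] [Finite G] :
    IsLarge (generalisedFittingSubgroup G) :=
  ⟨inferInstance, centralizer_generalisedFittingSubgroup_le G⟩
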